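/- Let $d\in\mathbb N$ and let $\varphi:\mathbb R\to\mathbb R$ be convex, differentiable and strictly decreasing with $\varphi(0)=0$; for positive densities $p,q$ on $\mathbb R^d$ put $$D_\varphi(p\|q)=\int_{\mathbb R^d}\varphi\Big(\log\frac{p(z)}{q(z)}\Big)\,q(z)\,dz .$$ Let $q_0$ be a positive probability density on $\mathbb R^d$ that is spherically symmetric about the origin, and let $\mathcal Q=\{q_{\nu,S}\}$ be the location-scale family $q_{\nu,S}(z)=q_0\big(S^{-1/2}(z-\nu)\big)\,|S|^{-1/2}$, where $\nu\in\mathbb R^d$, $S\in\mathbb R^{d\times d}$ is positive definite, $S^{1/2}$ is its positive-definite square root and $|S|$ its determinant. Let $p$ be a probability density on $\mathbb R^d$ that is log concave on $\mathbb R^d$ and strictly log concave on some nonempty open set. Suppose that $p$ is elliptically symmetric about $\mu\in\mathbb R^d$ with normalized covariance matrix $M$, that is, $M$ is positive definite, $\operatorname{trace}(M)=d$, and $p(z)=p(z')$ whenever $(z-\mu)^\top M^{-1}(z-\mu)=(z'-\mu)^\top M^{-1}(z'-\mu)$. Write $p(z)=p_0\big(M^{-1/2}(z-\mu)\big)\,|M|^{-1/2}$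 and suppose that $\log p_0(t)=f(\|t\|)$ for all $t \in \mathbb R^d$, where $f:[0,\infty)\to\mathbb R$ is continuously differentiable on $[0,\infty)$ (one-sidedly at $0$, so that $|f'(0)|<\infty$). Suppose finally that $D_\varphi(p\|q_{\nu,S})$ is finite (its integrand is integrable) for every $\nu\in\mathbb R^d$ and every positive-definite $S$. Then there is $\gamma>0$ such that $(\nu,S)=(\mu,\gamma^2M)$ is the unique minimizer of $D_\varphi(p\|q_{\nu,S})$ over all $\nu\in\mathbb R^d$ and all positive-definite $S\in\mathbb R^{d\times d}$. -/

import Mathlib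

open MeasureTheory

noncomputable section

namespace PhiVI

/-- Euclidean space of dimension `d`. -/
abbrev E (d : ℕ) : Type := EuclideanSpace ℝ (Fin d)

/-- A probability density with respect to Lebesgue measure. -/
structure IsDensity {d : ℕ} (g : E d → ℝ) : Prop where
  nonneg : ∀ z, 0 ≤ g z
  integrable : Integrable g volume
  integral_eq_one : ∫ z, g z = 1

/-- Spherical symmetry about the origin. -/
def SphericallySymmetric {d : ℕ} (g : E d → ℝ) : Prop :=
  ∀ x y : E d, ‖x‖ = ‖y‖ → g x = g y

section
open scoped MatrixOrder

/-- The natural (positive semidefinite) square root of a positive semidefinite matrix. -/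
def matSqrt {d : ℕ} (S : Matrix (Fin d) (Fin d) ℝ) : Matrix (Fin d) (Fin d) ℝ :=
  CFC.sqrt S

end

/-- The action of a matrix on Euclidean space. -/
def act {d : ℕ} (A : Matrix (Fin d) (Fin d) ℝ) (x : E d) : E d :=
  Matrix.toEuclideanCLM (n := Fin d) (𝕜 := ℝ) A x

/-- The member `z ↦ g (S^{-1/2} (z - ν)) |S|^{-1/2}` of the location-scale family with base
function `g`, with location `ν` and (positive-definite) scale matrix `S`. -/
def locScale {d : ℕ} (g : E d → ℝ) (ν : E d) (S : Matrix (Fin d) (Fin d) ℝ) (z : E d) : ℝ :=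
  g (act (matSqrt S)⁻¹ (z - ν)) * (Real.sqrt S.det)⁻¹

/-- The requirements on the function `φ` that generates a `φ`-divergence. -/
structure IsDivergenceGenerator (φ : ℝ → ℝ) : Prop where
  map_zero : φ 0 = 0
  convex : ConvexOn ℝ Set.univ φ
  differentiable : Differentiable ℝ φ

/-- The integrand `φ (log (p / q)) q` of the `φ`-divergence. -/
def phiIntegrand {d : ℕ} (φ : ℝ → ℝ) (p q : E d → ℝ) (z : E d) : ℝ :=
  φ (Real.log (p z / q z)) * q z

/-- The `φ`-divergence `D_φ(p‖q) = ∫ φ (log (p / q)) q` (meaningful when the integrand is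
integrable and `p`, `q` are positive). -/
def phiDiv {d : ℕ} (φ : ℝ → ℝ) (p q : E d → ℝ) : ℝ :=
  ∫ z, phiIntegrand φ p q z

/-- Log concavity of a nonnegative function on a convex set (zeros are allowed). -/
def LogConcaveOn {d : ℕ} (s : Set (E d)) (g : E d → ℝ) : Prop :=
  Convex ℝ s ∧ (∀ x ∈ s, 0 ≤ g x) ∧
    ∀ x ∈ s, ∀ y ∈ s, ∀ a b : ℝ, 0 < a → 0 < b → a + b = 1 →
      g x ^ a * g y ^ b ≤ g (a • x + b • y)

/-- Strict log concavity of a nonnegative function on a convex set. -/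
def StrictLogConcaveOn {d : ℕ} (s : Set (E d)) (g : E d → ℝ) : Prop :=
  Convex ℝ s ∧ (∀ x ∈ s, 0 ≤ g x) ∧
    ∀ x ∈ s, ∀ y ∈ s, x ≠ y → ∀ a b : ℝ, 0 < a → 0 < b → a + b = 1 →
      g x ^ a * g y ^ b < g (a • x + b • y)

/-- Log concave everywhere and strictly log concave on some nonempty open set. Asking the open set
to be convex is no restriction, since it can be shrunk to a ball. -/
def SomewhereStrictlyLogConcave {d : ℕ} (g : E d → ℝ) : Prop :=
  LogConcaveOn Set.univ g ∧
    ∃ U : Set (E d), IsOpen U ∧ U.Nonempty ∧ StrictLogConcaveOn U g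

/-- The Mahalanobis distance `√((z - ν)ᵀ M⁻¹ (z - ν))`. -/
def mahalanobis {d : ℕ} (M : Matrix (Fin d) (Fin d) ℝ) (z ν : E d) : ℝ :=
  Real.sqrt (inner ℝ (z - ν) (act M⁻¹ (z - ν)))

/-- `g` is elliptically symmetric about `ν` with normalized matrix `M`. -/
structure EllipticallySymmetric {d : ℕ} (g : E d → ℝ) (ν : E d)
    (M : Matrix (Fin d) (Fin d) ℝ) : Prop where
  posDef : M.PosDef
  trace_eq : M.trace = d
  symm : ∀ z z' : E d, mahalanobis M z ν = mahalanobis M z' ν → g z = g z'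

/-- `f` is a (real-valued) radial log-profile of `p`, relative to `μ` and `M`:
`p z = p₀ (M^{-1/2} (z - μ)) |M|^{-1/2}` where `p₀ > 0` and `f ‖t‖ = log (p₀ t)`.
Only the values of `f` on `[0, ∞)` matter. -/
def IsRadialLogProfile {d : ℕ} (f : ℝ → ℝ) (p : E d → ℝ) (μ : E d)
    (M : Matrix (Fin d) (Fin d) ℝ) : Prop :=
  ∃ p₀ : E d → ℝ, (∀ z, p z = locScale p₀ μ M z) ∧
    ∀ t, 0 < p₀ t ∧ f ‖t‖ = Real.log (p₀ t)

end PhiVI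

end

/-! Write `S = A Aᵀ` with `A = M^{1/2} U diag(l)` and `U` orthogonal, and put the location at `μ +
M^{1/2} U b`. Because `q₀` is radial, substituting `z = ν + A x` turns the divergence into the
integral of `φ(k(b + l x) + ∑ log lᵢ - log q₀(x)) q₀(x)`, where `k(t) = f(‖t‖)` is radial and
concave. Neither `U` nor `M` survives.

Three reductions follow. Reflection `x ↦ -x` makes `b` and `-b` equally good, and concavity of `k`,
strict on an open set, makes their midpoint `0` strictly better (`integral_center_lt`). At `b = 0`
the integral is strictly convex in `l`, since `∑ log lᵢ` is strictly concave and `φ` is convex and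
strictly decreasing. It is also invariant under permuting the axes, so averaging cyclic shifts shows
that equal axes are strictly better (`integral_mean_lt`). What remains is a strictly convex function
of one scale `γ`. It exceeds its value at `1` for some small and some large `γ`, so it has a unique
minimizer (`exists_isMinOn_const`). Equal axes `γ` mean `S = γ² M`. -/

noncomputable section

namespace PhiVI

open Filter Topology

variable {d : ℕ}

/-! ### The divergence in axis coordinates -/

/-- Coordinatewise scaling of Euclidean space. -/
def scaleBy (l : Fin d → ℝ) (x : E d) : E d := WithLp.toLp 2 fun i => l i * x i

@[simp]
theorem scaleBy_apply (l : Fin d → ℝ) (x : E d) (i : Fin d) : scaleBy l x i = l i * x i := rfl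

theorem scaleBy_add_smul (l m : Fin d → ℝ) (a b : ℝ) (x : E d) :
    scaleBy (a • l + b • m) x = a • scaleBy l x + b • scaleBy m x := by
  ext i
  simp
  ring

theorem scaleBy_const (γ : ℝ) (x : E d) : scaleBy (fun _ => γ) x = γ • x := by
  ext i
  simp

theorem scaleBy_neg (l : Fin d → ℝ) (x : E d) : scaleBy l (-x) = -scaleBy l x := by
  ext i
  simp

/-- The logarithm of the density ratio of the rescaled log profile `k` and `q₀`. -/
def logRatio (k q₀ : E d → ℝ) (b : E d) (l : Fin d → ℝ) (x : E d) : ℝ :=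
  k (b + scaleBy l x) + ∑ i, Real.log (l i) - Real.log (q₀ x)

/-- The divergence integrand in the coordinates of `q₀`, with location `b` and axes `l`. -/
def axisIntegrand (φ : ℝ → ℝ) (k q₀ : E d → ℝ) (b : E d) (l : Fin d → ℝ) (x : E d) : ℝ :=
  φ (logRatio k q₀ b l x) * q₀ x

/-- The data of the minimization problem in axis coordinates: `k` is the log profile of the target
density and `q₀` is the base density of the location-scale family. -/
structure AxisProblem (φ : ℝ → ℝ) (k q₀ : E d → ℝ) : Prop where
  convex : ConvexOn ℝ Set.univ φ
  anti : StrictAnti φ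
  map_zero : φ 0 = 0
  density : IsDensity q₀
  pos : ∀ x, 0 < q₀ x
  symm : SphericallySymmetric q₀
  profile_symm : SphericallySymmetric k
  profile_concave : ConcaveOn ℝ Set.univ k
  profile_strict : ∃ V : Set (E d), IsOpen V ∧ V.Nonempty ∧ StrictConcaveOn ℝ V k
  integrable : ∀ (b : E d) (l : Fin d → ℝ), (∀ i, 0 < l i) →
    Integrable (axisIntegrand φ k q₀ b l) volume

/-- The positive orthant. -/
def positiveOrthant (d : ℕ) : Set (Fin d → ℝ) := {l | ∀ i, 0 < l i}

theorem convex_positiveOrthant : Convex ℝ (positiveOrthant d) := by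
  intro l hl m hm a b ha hb hab i
  have h1 := hl i
  have h2 := hm i
  simp only [Pi.add_apply, Pi.smul_apply, smul_eq_mul]
  rcases ha.eq_or_lt with rfl | ha
  · have : b = 1 := by linarith
    subst this
    simpa using h2
  · positivity

/-! ### Strict comparison of integrals -/

theorem integral_lt_integral_of_lt_on_open {f g : E d → ℝ} (hf : Integrable f volume)
    (hg : Integrable g volume) (hle : ∀ x, f x ≤ g x) {V : Set (E d)} (hV : IsOpen V)
    (hne : V.Nonempty) (hlt : ∀ x ∈ V, f x < g x) : ∫ x, f x < ∫ x, g x := by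
  have h : 0 < ∫ x, (g x - f x) := by
    rw [integral_pos_iff_support_of_nonneg_ae (ae_of_all _ fun x => sub_nonneg.2 (hle x))
      (hg.sub hf)]
    refine lt_of_lt_of_le (hV.measure_pos volume hne) (measure_mono fun x hx => ?_)
    exact (sub_pos.2 (hlt x hx)).ne'
  rw [integral_sub hg hf] at h
  linarith

/-- A sequence of integrable functions with a common integrable lower bound that eventually
exceeds, at each point, a function of positive integral has a member of positive integral. -/
theorem exists_integral_pos_of_eventually_le {u : ℕ → E d → ℝ} {g w : E d → ℝ}
    (hu : ∀ n, Integrable (u n) volume) (hg : Integrable g volume) (hw : Integrable w volume)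
    (hgu : ∀ n x, g x ≤ u n x) (hev : ∀ᵐ x, ∀ᶠ n in atTop, w x ≤ u n x) (hpos : 0 < ∫ x, w x) :
    ∃ n, 0 < ∫ x, u n x := by
  -- Truncating at `w` supplies the missing upper bound: the minimum is dominated by `|g| + |w|` and
  -- eventually equals `w`.
  have ht : Tendsto (fun n => ∫ x, min (u n x) (w x)) atTop (𝓝 (∫ x, w x)) := by
    refine tendsto_integral_of_dominated_convergence (fun x => |g x| + |w x|)
      (fun n => ((hu n).inf hw).aestronglyMeasurable) (hg.abs.add hw.abs) (fun n => ae_of_all _ fun x => ?_) ?_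
    · rw [Real.norm_eq_abs, abs_le]
      have h1 := hgu n x
      have h2 := neg_abs_le (g x)
      have h3 := neg_abs_le (w x)
      have h4 := abs_nonneg (g x)
      have h5 := abs_nonneg (w x)
      refine ⟨?_, ?_⟩
      · exact le_min (by linarith) (by linarith)
      · exact (min_le_right _ _).trans (by linarith [le_abs_self (w x)])
    · filter_upwards [hev] with x hx
      refine tendsto_const_nhds.congr' ?_
      filter_upwards [hx] with n hn
      exact (min_eq_right hn).symm
  obtain ⟨n, hn⟩ := (ht.eventually (lt_mem_nhds hpos)).exists
  exact ⟨n, hn.trans_le (integral_mono ((hu n).inf hw) (hu n) fun x => min_le_left _ _)⟩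

/-- The log-determinant term is the source of strict convexity in the axes. -/
theorem sum_log_add_lt {l m : Fin d → ℝ} (hl : l ∈ positiveOrthant d) (hm : m ∈ positiveOrthant d)
    (hne : l ≠ m) {a b : ℝ} (ha : 0 < a) (hb : 0 < b) (hab : a + b = 1) :
    a * ∑ i, Real.log (l i) + b * ∑ i, Real.log (m i) < ∑ i, Real.log ((a • l + b • m) i) := by
  rw [Finset.mul_sum, Finset.mul_sum, ← Finset.sum_add_distrib]
  obtain ⟨j, hj⟩ := Function.ne_iff.1 hne
  refine Finset.sum_lt_sum (fun i _ => ?_) ⟨j, Finset.mem_univ j, ?_⟩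
  · exact strictConcaveOn_log_Ioi.concaveOn.2 (hl i) (hm i) ha.le hb.le hab
  · exact strictConcaveOn_log_Ioi.2 (hl j) (hm j) hj ha hb hab

/-! ### Convexity, centering and averaging of axes -/

namespace AxisProblem

variable {φ : ℝ → ℝ} {k q₀ : E d → ℝ}

theorem profile_neg (h : AxisProblem φ k q₀) (x : E d) : k (-x) = k x :=
  h.profile_symm _ _ (norm_neg x)

theorem profile_le_zero (h : AxisProblem φ k q₀) (x : E d) : k x ≤ k 0 := by
  have := h.profile_concave.2 (Set.mem_univ x) (Set.mem_univ (-x)) (by norm_num : (0:ℝ) ≤ 1/2)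
    (by norm_num : (0:ℝ) ≤ 1/2) (by norm_num)
  rw [h.profile_neg] at this
  simp only [smul_neg, add_neg_cancel, smul_eq_mul] at this
  linarith

/-- The argument of `φ` is strictly concave in `l` at every `x`, even where `k` is affine, because
`scaleBy l x` is linear in `l` and the logarithms are strictly concave. Then `φ` reverses the strict
inequality and its convexity finishes. -/
theorem strictConvexOn_axisIntegrand (h : AxisProblem φ k q₀) (x : E d) :
    StrictConvexOn ℝ (positiveOrthant d) fun l => axisIntegrand φ k q₀ 0 l x := by
  refine ⟨convex_positiveOrthant, fun l hl m hm hne a b ha hb hab => ?_⟩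
  have h1 := sum_log_add_lt hl hm hne ha hb hab
  have h2 := h.profile_concave.2 (Set.mem_univ (scaleBy l x)) (Set.mem_univ (scaleBy m x))
    ha.le hb.le hab
  rw [← scaleBy_add_smul] at h2
  simp only [smul_eq_mul] at h2 ⊢
  have h3 : a * logRatio k q₀ 0 l x + b * logRatio k q₀ 0 m x
      < logRatio k q₀ 0 (a • l + b • m) x := by
    simp only [logRatio, zero_add]
    have : a * Real.log (q₀ x) + b * Real.log (q₀ x) = Real.log (q₀ x) := by
      rw [← add_mul, hab, one_mul]
    linarith
  have h4 := h.convex.2 (Set.mem_univ (logRatio k q₀ 0 l x))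
    (Set.mem_univ (logRatio k q₀ 0 m x)) ha.le hb.le hab
  simp only [smul_eq_mul] at h4
  have h5 := mul_lt_mul_of_pos_right ((h.anti h3).trans_le h4) (h.pos x)
  simp only [axisIntegrand]
  linarith

theorem strictConvexOn_integral (h : AxisProblem φ k q₀) :
    StrictConvexOn ℝ (positiveOrthant d) fun l => ∫ x, axisIntegrand φ k q₀ 0 l x := by
  refine ⟨convex_positiveOrthant, fun l hl m hm hne a b ha hb hab => ?_⟩
  have il := h.integrable 0 l hl
  have im := h.integrable 0 m hm
  have hi := h.integrable 0 _ (convex_positiveOrthant hl hm ha.le hb.le hab)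
  simp only [smul_eq_mul]
  rw [← integral_const_mul, ← integral_const_mul,
    ← integral_add (il.const_mul a) (im.const_mul b)]
  have hlt := fun x => (h.strictConvexOn_axisIntegrand x).2 hl hm hne ha hb hab
  simp only [smul_eq_mul] at hlt
  exact integral_lt_integral_of_lt_on_open hi ((il.const_mul a).add (im.const_mul b))
    (fun x => (hlt x).le) isOpen_univ Set.univ_nonempty fun x _ => hlt x

/-- Centering the location at the origin strictly decreases the divergence. -/
theorem integral_center_lt (h : AxisProblem φ k q₀) {b : E d} (hb : b ≠ 0) {l : Fin d → ℝ}
    (hl : l ∈ positiveOrthant d) :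
    ∫ x, axisIntegrand φ k q₀ 0 l x < ∫ x, axisIntegrand φ k q₀ b l x := by
  have hsym : ∀ x, axisIntegrand φ k q₀ (-b) l x = axisIntegrand φ k q₀ b l (-x) := by
    intro x
    have h1 : q₀ (-x) = q₀ x := h.symm _ _ (norm_neg x)
    have h2 : k (-b + scaleBy l x) = k (b + scaleBy l (-x)) := by
      rw [← h.profile_neg, scaleBy_neg]
      congr 1
      abel
    simp only [axisIntegrand, logRatio, h1, h2]
  have hneg : ∫ x, axisIntegrand φ k q₀ (-b) l x = ∫ x, axisIntegrand φ k q₀ b l x := by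
    simp_rw [hsym]
    exact integral_neg_eq_self (axisIntegrand φ k q₀ b l) volume
  have ib := h.integrable b l hl
  have inb := h.integrable (-b) l hl
  have hmid : ∫ x, axisIntegrand φ k q₀ b l x = ∫ x, (1/2 : ℝ) *
      (axisIntegrand φ k q₀ b l x + axisIntegrand φ k q₀ (-b) l x) := by
    rw [integral_const_mul, integral_add ib inb, hneg]
    ring
  rw [hmid]
  obtain ⟨V, hV, ⟨v, hv⟩, hstrict⟩ := h.profile_strict
  have hkle : ∀ t, 1/2 * (k (b + t) + k (-b + t)) ≤ k t := by
    intro t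
    have h2 := h.profile_concave.2 (Set.mem_univ (b + t)) (Set.mem_univ (-b + t))
      (by norm_num : (0:ℝ) ≤ 1/2) (by norm_num : (0:ℝ) ≤ 1/2) (by norm_num)
    rw [show (1/2 : ℝ) • (b + t) + (1/2 : ℝ) • (-b + t) = t by module] at h2
    simp only [smul_eq_mul] at h2
    linarith
  -- The points `t ± b` may leave `V`, so strictness is taken at `t ± s b` with `s` small. Concavity
  -- on the segments from `t` to `t ± b` carries it to the full step.
  have hklt : ∀ t ∈ V, 1/2 * (k (b + t) + k (-b + t)) < k t := by
    intro t ht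
    obtain ⟨ε, hε, hball⟩ := Metric.isOpen_iff.1 hV t ht
    obtain ⟨s, hs0, hs1, hsε⟩ : ∃ s : ℝ, 0 < s ∧ s < 1 ∧ s * ‖b‖ < ε := by
      have hbn : 0 < ‖b‖ := norm_pos_iff.2 hb
      refine ⟨min (1/2) (ε / ‖b‖ / 2), by positivity, ?_, ?_⟩
      · exact (min_le_left _ _).trans_lt (by norm_num)
      · calc min (1/2) (ε / ‖b‖ / 2) * ‖b‖ ≤ ε / ‖b‖ / 2 * ‖b‖ := by gcongr; exact min_le_right _ _
          _ = ε / 2 := by field_simp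
          _ < ε := by linarith
    have hmem : ∀ r : ℝ, |r| = s → t + r • b ∈ V := fun r hr => hball (by
      simpa [dist_eq_norm, norm_smul, hr] using hsε)
    have hp := hmem s (abs_of_pos hs0)
    have hm := hmem (-s) (by rw [abs_neg, abs_of_pos hs0])
    have hne : t + s • b ≠ t + (-s) • b := by
      intro he
      have he' := add_left_cancel he
      rw [neg_smul] at he'
      have h0 : (2 * s) • b = 0 := by
        rw [two_mul, add_smul]
        nth_rewrite 1 [he']
        simp
      rcases smul_eq_zero.1 h0 with h0 | h0
      · linarith
      · exact hb h0
    have hst := hstrict.2 hp hm hne (by norm_num : (0:ℝ) < 1/2) (by norm_num : (0:ℝ) < 1/2)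
      (by norm_num)
    have e : (1/2 : ℝ) • (t + s • b) + (1/2 : ℝ) • (t + (-s) • b) = t := by
      module
    rw [e] at hst
    have c1 := h.profile_concave.2 (Set.mem_univ t) (Set.mem_univ (b + t))
      (by linarith : (0:ℝ) ≤ 1 - s) hs0.le (by ring)
    have c2 := h.profile_concave.2 (Set.mem_univ t) (Set.mem_univ (-b + t))
      (by linarith : (0:ℝ) ≤ 1 - s) hs0.le (by ring)
    rw [show (1 - s) • t + s • (b + t) = t + s • b by module] at c1
    rw [show (1 - s) • t + s • (-b + t) = t + (-s) • b by module] at c2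
    simp only [smul_eq_mul] at c1 c2 hst
    have : s * (1/2 * (k (b + t) + k (-b + t))) < s * k t := by nlinarith
    exact lt_of_mul_lt_mul_left this hs0.le
  have hlog : ∀ x, k (scaleBy l x) - 1/2 * (k (b + scaleBy l x) + k (-b + scaleBy l x)) =
      logRatio k q₀ 0 l x - (1/2 * logRatio k q₀ b l x + 1/2 * logRatio k q₀ (-b) l x) := by
    intro x
    simp only [logRatio, zero_add]
    ring
  have hφ : ∀ x, φ (1/2 * logRatio k q₀ b l x + 1/2 * logRatio k q₀ (-b) l x) ≤
      1/2 * φ (logRatio k q₀ b l x) + 1/2 * φ (logRatio k q₀ (-b) l x) := by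
    intro x
    have := h.convex.2 (Set.mem_univ (logRatio k q₀ b l x))
      (Set.mem_univ (logRatio k q₀ (-b) l x)) (by norm_num : (0:ℝ) ≤ 1/2)
      (by norm_num : (0:ℝ) ≤ 1/2) (by norm_num)
    simpa only [smul_eq_mul] using this
  have hcont : Continuous (scaleBy l) := by
    unfold scaleBy
    fun_prop
  refine integral_lt_integral_of_lt_on_open (h.integrable 0 l hl) ((ib.add inb).const_mul _)
    (fun x => ?_) (hV.preimage hcont) ⟨scaleBy (fun i => (l i)⁻¹) v, ?_⟩ fun x hx => ?_
  · have h1 := h.anti.antitone (show 1/2 * logRatio k q₀ b l x + 1/2 * logRatio k q₀ (-b) l x ≤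
      logRatio k q₀ 0 l x by linarith [hlog x, hkle (scaleBy l x)])
    have h2 := mul_le_mul_of_nonneg_right (h1.trans (hφ x)) (h.pos x).le
    simp only [axisIntegrand]
    linarith
  · have : scaleBy l (scaleBy (fun i => (l i)⁻¹) v) = v := by
      ext i
      simp [mul_inv_cancel_left₀ (hl i).ne']
    simpa [this] using hv
  · have h1 := h.anti (show 1/2 * logRatio k q₀ b l x + 1/2 * logRatio k q₀ (-b) l x <
      logRatio k q₀ 0 l x by linarith [hlog x, hklt (scaleBy l x) hx])
    have h2 := mul_lt_mul_of_pos_right (h1.trans_le (hφ x)) (h.pos x)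
    simp only [axisIntegrand]
    linarith

/-- Permuting coordinates is a measure-preserving isometry, so the radial `q₀` and `k` do not see
it. -/
theorem integral_perm (h : AxisProblem φ k q₀) (σ : Equiv.Perm (Fin d)) (l : Fin d → ℝ) :
    ∫ x, axisIntegrand φ k q₀ 0 (l ∘ σ) x = ∫ x, axisIntegrand φ k q₀ 0 l x := by
  let e := LinearIsometryEquiv.piLpCongrLeft 2 ℝ ℝ σ
  have he : ∀ x i, e x i = x (σ.symm i) := fun x i => rfl
  have hx : ∀ x, axisIntegrand φ k q₀ 0 (l ∘ σ) x = axisIntegrand φ k q₀ 0 l (e x) := by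
    intro x
    have h1 : q₀ (e x) = q₀ x := h.symm _ _ (e.norm_map x)
    have h2 : k (0 + scaleBy (l ∘ σ) x) = k (0 + scaleBy l (e x)) := by
      refine h.profile_symm _ _ ?_
      rw [zero_add, zero_add, ← e.norm_map]
      congr 1
      ext i
      simp [he]
    simp only [axisIntegrand, logRatio, h1, h2, Function.comp_apply,
      Equiv.sum_comp σ fun i => Real.log (l i)]
  simp_rw [hx]
  exact e.measurePreserving.integral_comp e.toHomeomorph.measurableEmbedding
    (axisIntegrand φ k q₀ 0 l)

/-- Replacing unequal axes by their mean strictly decreases the divergence. -/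
theorem integral_mean_lt [NeZero d] (h : AxisProblem φ k q₀) {l : Fin d → ℝ}
    (hl : l ∈ positiveOrthant d) (hne : ∃ i j, l i ≠ l j) :
    ∫ x, axisIntegrand φ k q₀ 0 (fun _ => (∑ i, l i) / d) x <
      ∫ x, axisIntegrand φ k q₀ 0 l x := by
  obtain ⟨i, j, hij⟩ := hne
  have hd : (d : ℝ) ≠ 0 := Nat.cast_ne_zero.2 (NeZero.ne d)
  -- Strict Jensen over the `d` cyclic shifts of `l`: all have the same integral and their average
  -- is the constant mean. The shifts by `i` and by `j` differ at index `0`.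
  have := h.strictConvexOn_integral.map_sum_lt (t := Finset.univ) (w := fun _ => (d : ℝ)⁻¹)
    (p := fun j : Fin d => l ∘ Equiv.addLeft j)
    (fun _ _ => by have : 0 < (d : ℝ) := Nat.cast_pos.2 (NeZero.pos d)
                   positivity)
    (by simp [hd]) (fun j _ i => hl _)
    ⟨i, Finset.mem_univ i, j, Finset.mem_univ j, fun he => hij (by
      simpa using congrFun he 0)⟩
  simp only [h.integral_perm, Finset.sum_const, Finset.card_univ, Fintype.card_fin, smul_eq_mul,
    nsmul_eq_mul, mul_inv_cancel_left₀ hd] at this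
  have e : (fun _ => (∑ i, l i) / (d : ℝ)) =
      ∑ j : Fin d, (d : ℝ)⁻¹ • (l ∘ Equiv.addLeft j) := by
    ext i
    simp only [Finset.sum_apply, Pi.smul_apply, Function.comp_apply, Equiv.coe_addLeft, smul_eq_mul]
    rw [← Finset.mul_sum, div_eq_inv_mul]
    congr 1
    exact (Equiv.sum_comp (Equiv.addRight i) l).symm
  rwa [e]

end AxisProblem

/-! ### Coercivity and the optimal common scale -/

theorem tendsto_mul_sub_mul_log_atTop {a : ℝ} (ha : 0 < a) (b : ℝ) :
    Tendsto (fun γ => a * γ - b * Real.log γ) atTop atTop := by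
  have h : (fun γ => b * Real.log γ) =o[atTop] fun γ : ℝ => γ :=
    Real.isLittleO_log_id_atTop.const_mul_left b
  have h' := h.bound (half_pos ha)
  refine tendsto_atTop_mono' atTop ?_ (tendsto_id.const_mul_atTop (half_pos ha))
  filter_upwards [h', eventually_ge_atTop 0] with γ h1 h0
  rw [Real.norm_eq_abs, Real.norm_eq_abs, abs_of_nonneg h0] at h1
  have := (le_abs_self _).trans h1
  simp only [id]
  linarith

namespace AxisProblem

variable {φ : ℝ → ℝ} {k q₀ : E d → ℝ}

theorem generator_neg_one_pos (h : AxisProblem φ k q₀) : 0 < φ (-1) := by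
  have := h.anti (by norm_num : (-1 : ℝ) < 0)
  rwa [h.map_zero] at this

/-- The point `-1` lies on the segment from `y` to `0`, and `φ` vanishes at `0`. Thus `φ` grows at
least linearly at `-∞`. -/
theorem mul_neg_le_generator (h : AxisProblem φ k q₀) {y : ℝ} (hy : y ≤ -1) :
    φ (-1) * (-y) ≤ φ y := by
  have hy0 : 0 < -y := by linarith
  have hle : 1 / (-y) ≤ 1 := by
    rw [div_le_one hy0]
    linarith
  have := h.convex.2 (Set.mem_univ y) (Set.mem_univ 0) (one_div_nonneg.2 hy0.le)
    (sub_nonneg.2 hle) (by ring)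
  simp only [smul_eq_mul, mul_zero, add_zero, h.map_zero] at this
  rw [show 1 / (-y) * y = -1 by field_simp [show y ≠ 0 by linarith]] at this
  calc φ (-1) * (-y) ≤ 1 / (-y) * φ y * (-y) := by gcongr
    _ = φ y := by field_simp [show y ≠ 0 by linarith]

theorem tendsto_generator_atBot (h : AxisProblem φ k q₀) : Tendsto φ atBot atTop := by
  refine tendsto_atTop_mono' atBot ?_ (tendsto_neg_atBot_atTop.const_mul_atTop
    h.generator_neg_one_pos)
  filter_upwards [eventually_le_atBot (-1 : ℝ)] with y hy
  exact h.mul_neg_le_generator hy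

/-- Otherwise `k` would be constantly equal to its maximum `k 0`, against strict concavity on an
open set. A nonzero direction is needed, hence `d ≠ 0`. -/
theorem exists_profile_lt_zero [NeZero d] (h : AxisProblem φ k q₀) : ∃ t, k t < k 0 := by
  obtain ⟨V, hV, ⟨v, hv⟩, hstrict⟩ := h.profile_strict
  obtain ⟨ε, hε, hball⟩ := Metric.isOpen_iff.1 hV v hv
  let e : E d := EuclideanSpace.single 0 (ε / 2)
  have hen : ‖e‖ = ε / 2 := by simp [e, abs_of_pos hε]
  have he0 : e ≠ 0 := by
    rw [← norm_pos_iff, hen]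
    positivity
  have hp : v + e ∈ V := hball (by simp [dist_eq_norm, hen, hε])
  have hm : v - e ∈ V := hball (by simp [hen, hε])
  have hne : v + e ≠ v - e := by
    intro he
    have h2 : (2 : ℝ) • e = (v + e) - (v - e) := by module
    rw [he, sub_self] at h2
    rcases smul_eq_zero.1 h2 with h2 | h2
    · norm_num at h2
    · exact he0 h2
  have hst := hstrict.2 hp hm hne (by norm_num : (0:ℝ) < 1/2) (by norm_num : (0:ℝ) < 1/2)
    (by norm_num)
  rw [show (1/2 : ℝ) • (v + e) + (1/2 : ℝ) • (v - e) = v by module] at hst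
  simp only [smul_eq_mul] at hst
  have := h.profile_le_zero v
  by_contra! hcon
  linarith [hcon (v + e), hcon (v - e)]

/-- A concave radial profile that is not constant decays at least linearly. -/
theorem exists_profile_le_sub_norm [NeZero d] (h : AxisProblem φ k q₀) :
    ∃ A ε : ℝ, 0 < ε ∧ ∀ x, k x ≤ A - ε * ‖x‖ := by
  obtain ⟨t, ht⟩ := h.exists_profile_lt_zero
  have ht0 : t ≠ 0 := by
    rintro rfl
    exact lt_irrefl _ ht
  have hr : 0 < ‖t‖ := norm_pos_iff.2 ht0
  -- The slope is that of the chord from `0` to `t`, which bounds `k` beyond radius `‖t‖`. Raising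
  -- the intercept by `k 0 - k t` covers the ball inside.
  refine ⟨2 * k 0 - k t, (k 0 - k t) / ‖t‖, div_pos (by linarith) hr, fun x => ?_⟩
  rcases le_or_gt ‖x‖ ‖t‖ with hx | hx
  · have h1 := h.profile_le_zero x
    have h2 : (k 0 - k t) / ‖t‖ * ‖x‖ ≤ k 0 - k t := by
      rw [div_mul_eq_mul_div, div_le_iff₀ hr]
      exact mul_le_mul_of_nonneg_left hx (by linarith)
    linarith
  · have hx0 : 0 < ‖x‖ := hr.trans hx
    have hle : ‖t‖ / ‖x‖ ≤ 1 := by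
      rw [div_le_one hx0]
      exact hx.le
    have hc := h.profile_concave.2 (Set.mem_univ x) (Set.mem_univ 0)
      (div_pos hr hx0).le (sub_nonneg.2 hle) (by ring)
    have hk : k ((‖t‖ / ‖x‖) • x) = k t := h.profile_symm _ _ (by
      rw [norm_smul, Real.norm_eq_abs, abs_of_pos (div_pos hr hx0), div_mul_cancel₀ _ hx0.ne'])
    rw [smul_zero, add_zero, hk] at hc
    simp only [smul_eq_mul] at hc
    have h1 : ‖t‖ / ‖x‖ * (k x - k 0) ≤ k t - k 0 := by linarith
    rw [div_mul_eq_mul_div, div_le_iff₀ hx0] at h1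
    have h2 : k x - k 0 ≤ -((k 0 - k t) / ‖t‖ * ‖x‖) := by
      rw [div_mul_eq_mul_div, ← neg_div, le_div_iff₀ hr]
      linarith
    linarith

theorem logRatio_const (γ : ℝ) (x : E d) :
    logRatio k q₀ 0 (fun _ => γ) x = k (γ • x) + d * Real.log γ - Real.log (q₀ x) := by
  simp [logRatio, scaleBy_const]

theorem convexOn_axisIntegrand_const (h : AxisProblem φ k q₀) (x : E d) :
    ConvexOn ℝ (Set.Ioi 0) fun γ : ℝ => axisIntegrand φ k q₀ 0 (fun _ => γ) x := by
  refine ⟨convex_Ioi 0, fun a ha b hb s t hs ht hst => ?_⟩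
  exact (h.strictConvexOn_axisIntegrand x).convexOn.2 (fun _ => ha) (fun _ => hb) hs ht hst

theorem strictConvexOn_integral_const [NeZero d] (h : AxisProblem φ k q₀) :
    StrictConvexOn ℝ (Set.Ioi 0) fun γ : ℝ => ∫ x, axisIntegrand φ k q₀ 0 (fun _ => γ) x := by
  refine ⟨convex_Ioi 0, fun a ha b hb hab s t hs ht hst => ?_⟩
  exact h.strictConvexOn_integral.2 (x := fun _ => a) (y := fun _ => b) (fun _ => ha) (fun _ => hb)
    (fun he => hab (congrFun he 0)) hs ht hst

/-- As `γ → 0` the term `d log γ` drives the log ratio to `-∞`, since `k ≤ k 0`, so the integrand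
tends to infinity pointwise. Along `γ = 1/(n+2)` its increment from `γ = 1` eventually exceeds `q₀`,
whose integral is `1`. -/
theorem exists_small_integral_gt [NeZero d] (h : AxisProblem φ k q₀) :
    ∃ γ : ℝ, 0 < γ ∧ γ < 1 ∧ ∫ x, axisIntegrand φ k q₀ 0 (fun _ => 1) x <
      ∫ x, axisIntegrand φ k q₀ 0 (fun _ => γ) x := by
  have hint : ∀ {γ : ℝ}, 0 < γ → Integrable (axisIntegrand φ k q₀ 0 fun _ => γ) volume :=
    fun hγ => h.integrable 0 _ fun _ => hγ
  have hpos : ∀ n : ℕ, (0 : ℝ) < ((n : ℝ) + 2)⁻¹ := fun n => by positivity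
  have hlt : ∀ n : ℕ, ((n : ℝ) + 2)⁻¹ < 1 := fun n =>
    inv_lt_one_of_one_lt₀ (by linarith [Nat.cast_nonneg (α := ℝ) n])
  have h1 := hint one_pos
  have h2 := hint two_pos
  suffices hn : ∃ n, 0 < ∫ x, (axisIntegrand φ k q₀ 0 (fun _ => ((n : ℕ) + 2 : ℝ)⁻¹) x -
      axisIntegrand φ k q₀ 0 (fun _ => 1) x) by
    obtain ⟨n, hn⟩ := hn
    refine ⟨_, hpos n, hlt n, ?_⟩
    rw [integral_sub (hint (hpos n)) h1] at hn
    linarith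
  refine exists_integral_pos_of_eventually_le (fun n => (hint (hpos n)).sub h1)
    (h2.sub h1).abs.neg h.density.integrable (fun n x => ?_) (ae_of_all _ fun x => ?_)
    (by rw [h.density.integral_eq_one]; exact one_pos)
  -- By convexity in `γ`, the line through the values at `1` and `2` lies below the graph to the
  -- left of `1`. This gives an integrable lower bound uniform in `n`.
  · have hs := (h.convexOn_axisIntegrand_const x).secant_mono (a := 1) (x := ((n : ℝ) + 2)⁻¹)
      (y := 2) (Set.mem_Ioi.2 one_pos) (hpos n) (Set.mem_Ioi.2 two_pos) (hlt n).ne (by norm_num)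
      (by linarith [hlt n])
    norm_num only at hs
    rw [div_one, div_le_iff_of_neg (by linarith [hlt n])] at hs
    simp only [Pi.neg_apply, Pi.sub_apply]
    refine le_trans ?_ hs
    have ha := abs_nonneg (axisIntegrand φ k q₀ 0 (fun _ => 2) x -
      axisIntegrand φ k q₀ 0 (fun _ => 1) x)
    have hb := le_abs_self (axisIntegrand φ k q₀ 0 (fun _ => 2) x -
      axisIntegrand φ k q₀ 0 (fun _ => 1) x)
    nlinarith [hpos n, hlt n]
  · have hinv : Tendsto (fun n : ℕ => Real.log ((n : ℝ) + 2)⁻¹) atTop atBot := by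
      simp_rw [Real.log_inv]
      exact tendsto_neg_atTop_atBot.comp (Real.tendsto_log_atTop.comp
        (tendsto_atTop_add_const_right _ _ tendsto_natCast_atTop_atTop))
    have hd : (0 : ℝ) < d := Nat.cast_pos.2 (NeZero.pos d)
    have hl : Tendsto (fun n : ℕ => logRatio k q₀ 0 (fun _ => ((n : ℝ) + 2)⁻¹) x) atTop atBot := by
      refine tendsto_atBot_mono (fun n => ?_) (tendsto_atBot_add_const_right _
        (k 0 - Real.log (q₀ x)) (hinv.const_mul_atBot hd))
      rw [logRatio_const]
      linarith [h.profile_le_zero (((n : ℝ) + 2)⁻¹ • x)]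
    have ht := (h.tendsto_generator_atBot.comp hl).atTop_mul_const (h.pos x)
    filter_upwards [ht.eventually_ge_atTop (q₀ x + axisIntegrand φ k q₀ 0 (fun _ => 1) x)] with n hn
    simp only [Function.comp_apply] at hn
    unfold axisIntegrand at hn ⊢
    linarith

/-- Linear decay of `k` beats `d log γ`. Secant slopes from `γ = 1` replace differences because, by
convexity, they are bounded below by the slope to `2`, uniformly in `n`. -/
theorem exists_large_integral_gt [NeZero d] (h : AxisProblem φ k q₀) :
    ∃ γ : ℝ, 1 < γ ∧ ∫ x, axisIntegrand φ k q₀ 0 (fun _ => 1) x <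
      ∫ x, axisIntegrand φ k q₀ 0 (fun _ => γ) x := by
  have hint : ∀ {γ : ℝ}, 0 < γ → Integrable (axisIntegrand φ k q₀ 0 fun _ => γ) volume :=
    fun hγ => h.integrable 0 _ fun _ => hγ
  have hpos : ∀ n : ℕ, (0 : ℝ) < (n : ℝ) + 2 := fun n => by positivity
  have hlt : ∀ n : ℕ, 1 < (n : ℝ) + 2 := fun n => by linarith [Nat.cast_nonneg (α := ℝ) n]
  have h1 := hint one_pos
  have h2 := hint two_pos
  obtain ⟨A, ε, hε, hdecay⟩ := h.exists_profile_le_sub_norm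
  set c := φ (-1) with hc
  have hc0 : 0 < c := h.generator_neg_one_pos
  -- The cutoff `min ‖x‖ 1` is there because `q₀` is not assumed to have a first moment.
  have hw : Integrable (fun x => (c * ε / 2 * min ‖x‖ 1) * q₀ x) volume := by
    refine h.density.integrable.bdd_mul (c := c * ε / 2) (by fun_prop) (ae_of_all _ fun x => ?_)
    rw [Real.norm_eq_abs, abs_of_nonneg (by positivity)]
    exact mul_le_of_le_one_right (by positivity) (min_le_right _ _)
  have hwpos : 0 < ∫ x, (c * ε / 2 * min ‖x‖ 1) * q₀ x := by
    have := integral_lt_integral_of_lt_on_open (integrable_zero (E d) ℝ volume) hw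
      (fun x => mul_nonneg (by positivity) (h.pos x).le) (V := {0}ᶜ) isOpen_compl_singleton
      ⟨EuclideanSpace.single 0 1, by simp⟩ (fun x hx => by
        have : 0 < ‖x‖ := norm_pos_iff.2 hx
        have := h.pos x
        positivity)
    simpa using this
  suffices hn : ∃ n, 0 < ∫ x, (axisIntegrand φ k q₀ 0 (fun _ => (n : ℕ) + 2) x -
      axisIntegrand φ k q₀ 0 (fun _ => 1) x) / ((n : ℝ) + 2 - 1) by
    obtain ⟨n, hn⟩ := hn
    refine ⟨_, hlt n, ?_⟩
    rw [integral_div, integral_sub (hint (hpos n)) h1] at hn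
    have := (div_pos_iff_of_pos_right (by linarith [hlt n])).1 hn
    linarith
  refine exists_integral_pos_of_eventually_le
    (fun n : ℕ => ((hint (hpos n)).sub h1).div_const ((n : ℝ) + 2 - 1))
    (h2.sub h1) hw (fun n x => ?_) ?_ hwpos
  · have hs := (h.convexOn_axisIntegrand_const x).secant_mono (a := 1) (x := 2)
      (y := (n : ℝ) + 2) (Set.mem_Ioi.2 one_pos) (Set.mem_Ioi.2 two_pos) (hpos n) (by norm_num)
      (hlt n).ne' (by linarith [Nat.cast_nonneg (α := ℝ) n])
    simp only [Pi.sub_apply]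
    refine le_trans (le_of_eq ?_) hs
    norm_num
  · have hne : ∀ᵐ x : E d, x ≠ 0 := by
      have : Nontrivial (E d) := ⟨⟨EuclideanSpace.single 0 1, 0, by simp⟩⟩
      exact Measure.ae_ne volume 0
    filter_upwards [hne] with x hx
    have hxn : 0 < ‖x‖ := norm_pos_iff.2 hx
    have hγ : Tendsto (fun n : ℕ => (n : ℝ) + 2) atTop atTop :=
      tendsto_atTop_add_const_right _ _ tendsto_natCast_atTop_atTop
    have hup : ∀ γ : ℝ, 0 < γ → logRatio k q₀ 0 (fun _ => γ) x ≤
        A - Real.log (q₀ x) - (ε * ‖x‖ * γ - d * Real.log γ) := by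
      intro γ hγ0
      have := hdecay (γ • x)
      rw [norm_smul, Real.norm_eq_abs, abs_of_pos hγ0] at this
      rw [logRatio_const]
      linarith
    -- `hA` brings the log ratio below `-1`, where the linear bound on `φ` applies. `hB` spends half
    -- of the slope `c ε ‖x‖` on the logarithm and the constants, leaving the other half for `w`.
    have hA := (tendsto_mul_sub_mul_log_atTop (show 0 < ε * ‖x‖ by positivity) d).comp hγ
    have hB := (tendsto_mul_sub_mul_log_atTop (show 0 < c * ε * ‖x‖ / 2 by positivity)
      (c * d)).comp hγ
    filter_upwards [hA.eventually_ge_atTop (A - Real.log (q₀ x) + 1), hB.eventually_ge_atTop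
      (c * (A - Real.log (q₀ x)) + φ (logRatio k q₀ 0 (fun _ => 1) x))] with n hnA hnB
    simp only [Function.comp_apply] at hnA hnB
    rw [le_div_iff₀ (by linarith [hlt n])]
    have hu := hup _ (hpos n)
    have hφ := h.mul_neg_le_generator (show logRatio k q₀ 0 (fun _ => (n : ℝ) + 2) x ≤ -1 by
      linarith)
    rw [← hc] at hφ
    have hcu := mul_le_mul_of_nonneg_left hu hc0.le
    have hmin : c * ε / 2 * min ‖x‖ 1 * ((n : ℝ) + 2 - 1) ≤ c * ε * ‖x‖ / 2 * ((n : ℝ) + 2) := by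
      calc c * ε / 2 * min ‖x‖ 1 * ((n : ℝ) + 2 - 1) ≤ c * ε / 2 * ‖x‖ * ((n : ℝ) + 2) := by
            gcongr
            · linarith [hlt n]
            · exact min_le_left _ _
            · linarith
        _ = _ := by ring
    have hfin : c * ε / 2 * min ‖x‖ 1 * ((n : ℝ) + 2 - 1) ≤
        φ (logRatio k q₀ 0 (fun _ => (n : ℝ) + 2) x) - φ (logRatio k q₀ 0 (fun _ => 1) x) := by
      linarith
    have := mul_le_mul_of_nonneg_right hfin (h.pos x).le
    unfold axisIntegrand
    linarith

theorem exists_isMinOn_const [NeZero d] (h : AxisProblem φ k q₀) :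
    ∃ γ : ℝ, 0 < γ ∧ ∀ γ', 0 < γ' → γ' ≠ γ →
      ∫ x, axisIntegrand φ k q₀ 0 (fun _ => γ) x < ∫ x, axisIntegrand φ k q₀ 0 (fun _ => γ') x := by
  obtain ⟨s, hs0, hs1, hs⟩ := h.exists_small_integral_gt
  obtain ⟨t, ht1, ht⟩ := h.exists_large_integral_gt
  have hconv := h.strictConvexOn_integral_const
  set G : ℝ → ℝ := fun γ => ∫ x, axisIntegrand φ k q₀ 0 (fun _ => γ) x with hG
  have hcont : ContinuousOn G (Set.Icc s t) :=
    (hconv.convexOn.continuousOn isOpen_Ioi).mono fun x hx => hs0.trans_le hx.1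
  obtain ⟨γ, hγ, hmin⟩ := isCompact_Icc.exists_isMinOn ⟨1, hs1.le, ht1.le⟩ hcont
  have hγ0 : 0 < γ := hs0.trans_le hγ.1
  have hγ1 : G γ ≤ G 1 := hmin ⟨hs1.le, ht1.le⟩
  -- Beyond an endpoint of `[s, t]`, that endpoint lies between `y` and `1`. Since its value exceeds
  -- `G 1`, convexity forces `G y` to be at least as large.
  have hglobal : IsMinOn G (Set.Ioi 0) γ := by
    intro y hy
    have hy0 : 0 < y := hy
    change G γ ≤ G y
    rcases lt_or_ge y s with hys | hys
    · have := hconv.convexOn.le_max_of_mem_Icc hy (Set.mem_Ioi.2 one_pos) ⟨hys.le, hs1.le⟩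
      rcases le_max_iff.1 this with h1 | h1
      · linarith
      · exact absurd h1 (not_le.2 hs)
    · rcases le_or_gt y t with hyt | hyt
      · exact hmin ⟨hys, hyt⟩
      · have := hconv.convexOn.le_max_of_mem_Icc (Set.mem_Ioi.2 one_pos) hy ⟨ht1.le, hyt.le⟩
        rcases le_max_iff.1 this with h1 | h1
        · exact absurd h1 (not_le.2 ht)
        · linarith
  refine ⟨γ, hγ0, fun γ' hγ' hne => lt_of_le_of_ne (hglobal hγ') fun he => hne ?_⟩
  refine hconv.eq_of_isMinOn (fun y hy => ?_) hglobal hγ' hγ0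
  have : G γ ≤ G y := hglobal hy
  change G γ' ≤ G y
  rw [← show G γ = G γ' from he]
  exact this

theorem exists_unique_minimizer [NeZero d] (h : AxisProblem φ k q₀) :
    ∃ γ : ℝ, 0 < γ ∧ ∀ (b : E d) (l : Fin d → ℝ), (∀ i, 0 < l i) →
      ¬(b = 0 ∧ l = fun _ => γ) →
      ∫ x, axisIntegrand φ k q₀ 0 (fun _ => γ) x < ∫ x, axisIntegrand φ k q₀ b l x := by
  obtain ⟨γ, hγ, hmin⟩ := h.exists_isMinOn_const
  have hmin' : ∀ γ', 0 < γ' → ∫ x, axisIntegrand φ k q₀ 0 (fun _ => γ) x ≤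
      ∫ x, axisIntegrand φ k q₀ 0 (fun _ => γ') x := by
    intro γ' hγ'
    rcases eq_or_ne γ' γ with rfl | hne
    · exact le_rfl
    · exact (hmin γ' hγ' hne).le
  have hcentered : ∀ l : Fin d → ℝ, (∀ i, 0 < l i) → l ≠ (fun _ => γ) →
      ∫ x, axisIntegrand φ k q₀ 0 (fun _ => γ) x < ∫ x, axisIntegrand φ k q₀ 0 l x := by
    intro l hl hne
    by_cases hconst : ∃ i j, l i ≠ l j
    · refine lt_of_le_of_lt (hmin' _ ?_) (h.integral_mean_lt hl hconst)
      exact div_pos (Finset.sum_pos (fun i _ => hl i) Finset.univ_nonempty)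
        (Nat.cast_pos.2 (NeZero.pos d))
    · push Not at hconst
      have hl0 : l = fun _ => l 0 := funext fun i => hconst i 0
      rw [hl0]
      refine hmin _ (hl 0) fun he => hne ?_
      rw [hl0, he]
  refine ⟨γ, hγ, fun b l hl hne => ?_⟩
  rcases eq_or_ne b 0 with rfl | hb
  · exact hcentered l hl fun he => hne ⟨rfl, he⟩
  · refine lt_of_le_of_lt ?_ (h.integral_center_lt hb hl)
    rcases eq_or_ne l (fun _ => γ) with rfl | hl'
    · exact le_rfl
    · exact (hcentered l hl hl').le

end AxisProblem

/-! ### Matrix actions and square roots -/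

theorem act_mul (A B : Matrix (Fin d) (Fin d) ℝ) (x : E d) : act (A * B) x = act A (act B x) := by
  simp [act]

theorem act_one (x : E d) : act 1 x = x := by
  simp [act]

theorem act_add (A : Matrix (Fin d) (Fin d) ℝ) (x y : E d) : act A (x + y) = act A x + act A y :=
  map_add _ _ _

theorem act_smul (A : Matrix (Fin d) (Fin d) ℝ) (a : ℝ) (x : E d) : act A (a • x) = a • act A x :=
  map_smul _ _ _

theorem act_diagonal (l : Fin d → ℝ) (x : E d) : act (Matrix.diagonal l) x = scaleBy l x := by
  ext i
  simp [act, Matrix.ofLp_toEuclideanCLM, Matrix.mulVec_diagonal]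

theorem act_inv_act {A : Matrix (Fin d) (Fin d) ℝ} (hA : A.det ≠ 0) (x : E d) :
    act A⁻¹ (act A x) = x := by
  rw [← act_mul, Matrix.nonsing_inv_mul _ (isUnit_iff_ne_zero.2 hA), act_one]

theorem act_act_inv {A : Matrix (Fin d) (Fin d) ℝ} (hA : A.det ≠ 0) (x : E d) :
    act A (act A⁻¹ x) = x := by
  rw [← act_mul, Matrix.mul_nonsing_inv _ (isUnit_iff_ne_zero.2 hA), act_one]

theorem act_injective {A : Matrix (Fin d) (Fin d) ℝ} (hA : A.det ≠ 0) :
    Function.Injective (act A) :=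
  Function.LeftInverse.injective (act_inv_act hA)

theorem continuous_act (A : Matrix (Fin d) (Fin d) ℝ) : Continuous (act A) :=
  (Matrix.toEuclideanCLM (n := Fin d) (𝕜 := ℝ) A).continuous

theorem norm_act_of_mul_transpose_eq_one {O : Matrix (Fin d) (Fin d) ℝ} (hO : O * O.transpose = 1)
    (x : E d) : ‖act O x‖ = ‖x‖ := by
  have hmem : O ∈ unitary (Matrix (Fin d) (Fin d) ℝ) :=
    Unitary.mem_iff.2 ⟨mul_eq_one_comm.1 hO, hO⟩
  exact ContinuousLinearMap.norm_map_of_mem_unitary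
    (Unitary.map_mem (Matrix.toEuclideanCLM (n := Fin d) (𝕜 := ℝ)) hmem) x

theorem det_toEuclideanCLM (A : Matrix (Fin d) (Fin d) ℝ) :
    (Matrix.toEuclideanCLM (n := Fin d) (𝕜 := ℝ) A).det = A.det := by
  rw [ContinuousLinearMap.det, Matrix.coe_toEuclideanCLM_eq_toEuclideanLin,
    Matrix.toEuclideanLin_eq_toLin_orthonormal, LinearMap.det_toLin]

section SquareRoot

open scoped MatrixOrder

variable {S : Matrix (Fin d) (Fin d) ℝ}

theorem matSqrt_mul_self (hS : S.PosDef) : matSqrt S * matSqrt S = S :=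
  CFC.sqrt_mul_sqrt_self S (Matrix.nonneg_iff_posSemidef.2 hS.posSemidef)

theorem transpose_matSqrt (S : Matrix (Fin d) (Fin d) ℝ) : (matSqrt S).transpose = matSqrt S := by
  have h := (Matrix.nonneg_iff_posSemidef.1 (CFC.sqrt_nonneg S)).isHermitian
  rwa [Matrix.IsHermitian, Matrix.conjTranspose_eq_transpose_of_trivial] at h

theorem abs_det_matSqrt (hS : S.PosDef) : |(matSqrt S).det| = Real.sqrt S.det := by
  rw [← Real.sqrt_mul_self_eq_abs, ← Matrix.det_mul, matSqrt_mul_self hS]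

theorem det_matSqrt_ne_zero (hS : S.PosDef) : (matSqrt S).det ≠ 0 := by
  rw [← abs_pos, abs_det_matSqrt hS]
  exact Real.sqrt_pos.2 hS.det_pos

end SquareRoot

/-! ### Location-scale densities and affine change of variables -/

theorem posDef_mul_transpose {A : Matrix (Fin d) (Fin d) ℝ} (hA : A.det ≠ 0) :
    (A * A.transpose).PosDef := by
  rw [← Matrix.conjTranspose_eq_transpose_of_trivial]
  refine Matrix.PosDef.mul_conjTranspose_self A ?_
  exact Matrix.vecMul_injective_of_isUnit ((Matrix.isUnit_iff_isUnit_det A).2 (isUnit_iff_ne_zero.2 hA))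

/-- The location-scale family of a spherically symmetric function depends on the factorization of
the scale matrix only through the scale matrix itself. -/
theorem locScale_mul_transpose {q₀ : E d → ℝ} (hq₀ : SphericallySymmetric q₀) (ν : E d)
    {A : Matrix (Fin d) (Fin d) ℝ} (hA : A.det ≠ 0) (x : E d) :
    locScale q₀ ν (A * A.transpose) (ν + act A x) = q₀ x * |A.det|⁻¹ := by
  have hS := posDef_mul_transpose hA
  have hdet : Real.sqrt (A * A.transpose).det = |A.det| := by
    rw [Matrix.det_mul, Matrix.det_transpose, Real.sqrt_mul_self_eq_abs]
  have hunit := isUnit_iff_ne_zero.2 (det_matSqrt_ne_zero hS)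
  set T := matSqrt (A * A.transpose) with hT
  -- Polar decomposition: `A` equals `T` times an orthogonal matrix, which the radial `q₀` ignores.
  have horth : (T⁻¹ * A) * (T⁻¹ * A).transpose = 1 := by
    rw [Matrix.transpose_mul, Matrix.transpose_nonsing_inv, hT, transpose_matSqrt, ← hT]
    calc T⁻¹ * A * (A.transpose * T⁻¹) = T⁻¹ * (A * A.transpose) * T⁻¹ := by
          simp only [Matrix.mul_assoc]
      _ = T⁻¹ * (T * T) * T⁻¹ := by rw [hT, matSqrt_mul_self hS]
      _ = 1 := by
          rw [← Matrix.mul_assoc, Matrix.nonsing_inv_mul _ hunit, Matrix.one_mul,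
            Matrix.mul_nonsing_inv _ hunit]
  rw [locScale, hdet, add_sub_cancel_left, ← act_mul]
  congr 1
  exact hq₀ _ _ (norm_act_of_mul_transpose_eq_one horth x)

theorem hasFDerivAt_add_act (A : Matrix (Fin d) (Fin d) ℝ) (ν x : E d) :
    HasFDerivAt (fun x => ν + act A x) (Matrix.toEuclideanCLM (n := Fin d) (𝕜 := ℝ) A) x :=
  (Matrix.toEuclideanCLM (n := Fin d) (𝕜 := ℝ) A).hasFDerivAt.const_add ν

theorem image_add_act_univ {A : Matrix (Fin d) (Fin d) ℝ} (hA : A.det ≠ 0) (ν : E d) :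
    (fun x => ν + act A x) '' Set.univ = Set.univ := by
  refine Set.eq_univ_of_forall fun y => ⟨act A⁻¹ (y - ν), Set.mem_univ _, ?_⟩
  simp only [act_act_inv hA, add_sub_cancel]

theorem integrable_iff_integrable_comp_add_act {A : Matrix (Fin d) (Fin d) ℝ} (hA : A.det ≠ 0)
    (ν : E d) (g : E d → ℝ) :
    Integrable g volume ↔ Integrable (fun x => |A.det| * g (ν + act A x)) volume := by
  have h := integrableOn_image_iff_integrableOn_abs_det_fderiv_smul volume MeasurableSet.univ
    (fun x _ => (hasFDerivAt_add_act A ν x).hasFDerivWithinAt)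
    ((add_right_injective ν).comp (act_injective hA)).injOn g
  rw [image_add_act_univ hA, integrableOn_univ, integrableOn_univ] at h
  simpa only [det_toEuclideanCLM, smul_eq_mul] using h

theorem integral_eq_integral_comp_add_act {A : Matrix (Fin d) (Fin d) ℝ} (hA : A.det ≠ 0)
    (ν : E d) (g : E d → ℝ) : ∫ z, g z = ∫ x, |A.det| * g (ν + act A x) := by
  have h := integral_image_eq_integral_abs_det_fderiv_smul volume MeasurableSet.univ
    (fun x _ => (hasFDerivAt_add_act A ν x).hasFDerivWithinAt)
    ((add_right_injective ν).comp (act_injective hA)).injOn g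
  rw [image_add_act_univ hA, setIntegral_univ, setIntegral_univ] at h
  simpa only [det_toEuclideanCLM, smul_eq_mul] using h

/-! ### Axis factorization of the scale matrix -/

/-- The matrix with principal axes given by the columns of `U`, of lengths `l`, in the coordinates
that normalize `M`. -/
def axisMatrix (M U : Matrix (Fin d) (Fin d) ℝ) (l : Fin d → ℝ) : Matrix (Fin d) (Fin d) ℝ :=
  matSqrt M * U * Matrix.diagonal l

theorem abs_det_eq_one_of_mul_transpose {U : Matrix (Fin d) (Fin d) ℝ}
    (hU : U * U.transpose = 1) : |U.det| = 1 := by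
  have h := congrArg Matrix.det hU
  rw [Matrix.det_mul, Matrix.det_transpose, Matrix.det_one] at h
  rw [← Real.sqrt_mul_self_eq_abs, h, Real.sqrt_one]

theorem abs_det_axisMatrix {M U : Matrix (Fin d) (Fin d) ℝ} (hM : M.PosDef)
    (hU : U * U.transpose = 1) {l : Fin d → ℝ} (hl : ∀ i, 0 < l i) :
    |(axisMatrix M U l).det| = Real.sqrt M.det * ∏ i, l i := by
  rw [axisMatrix, Matrix.det_mul, Matrix.det_mul, Matrix.det_diagonal, abs_mul, abs_mul,
    abs_det_matSqrt hM, abs_det_eq_one_of_mul_transpose hU, mul_one,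
    abs_of_pos (Finset.prod_pos fun i _ => hl i)]

theorem det_axisMatrix_ne_zero {M U : Matrix (Fin d) (Fin d) ℝ} (hM : M.PosDef)
    (hU : U * U.transpose = 1) {l : Fin d → ℝ} (hl : ∀ i, 0 < l i) :
    (axisMatrix M U l).det ≠ 0 := by
  rw [← abs_pos, abs_det_axisMatrix hM hU hl]
  exact mul_pos (Real.sqrt_pos.2 hM.det_pos) (Finset.prod_pos fun i _ => hl i)

theorem axisMatrix_const_mul_transpose {M U : Matrix (Fin d) (Fin d) ℝ} (hM : M.PosDef)
    (hU : U * U.transpose = 1) (γ : ℝ) :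
    axisMatrix M U (fun _ => γ) * (axisMatrix M U fun _ => γ).transpose = γ ^ 2 • M := by
  have hD : (Matrix.diagonal fun _ : Fin d => γ) = γ • (1 : Matrix (Fin d) (Fin d) ℝ) := by
    rw [Matrix.smul_one_eq_diagonal]
  rw [axisMatrix, hD, Matrix.mul_smul, Matrix.mul_one, Matrix.transpose_smul, Matrix.transpose_mul,
    transpose_matSqrt, Matrix.smul_mul, Matrix.mul_smul, smul_smul, ← sq, Matrix.mul_assoc,
    ← Matrix.mul_assoc U, hU, Matrix.one_mul, matSqrt_mul_self hM]

/-- Simultaneous diagonalization of the positive-definite matrices `M` and `S`. -/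
theorem exists_axisMatrix_mul_transpose {M S : Matrix (Fin d) (Fin d) ℝ} (hM : M.PosDef)
    (hS : S.PosDef) : ∃ (U : Matrix (Fin d) (Fin d) ℝ) (l : Fin d → ℝ), U * U.transpose = 1 ∧
      (∀ i, 0 < l i) ∧ S = axisMatrix M U l * (axisMatrix M U l).transpose := by
  have hR := det_matSqrt_ne_zero hM
  have hRt := transpose_matSqrt M
  set R := matSqrt M with hRdef
  have hunit := isUnit_iff_ne_zero.2 hR
  -- Diagonalizing `R⁻¹ S R⁻¹` gives `U`, and the axes `l` are the square roots of its eigenvalues.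
  have hT : ((R⁻¹).conjTranspose * S * R⁻¹).PosDef :=
    hS.conjTranspose_mul_mul_same (Matrix.mulVec_injective_of_isUnit
      ((Matrix.isUnit_iff_isUnit_det _).2 (Matrix.isUnit_nonsing_inv_det _ hunit)))
  have hinv : (R⁻¹).conjTranspose = R⁻¹ := by
    rw [Matrix.conjTranspose_eq_transpose_of_trivial, Matrix.transpose_nonsing_inv, hRt]
  rw [hinv] at hT
  have hspec := hT.isHermitian.spectral_theorem
  rw [Unitary.conjStarAlgAut_apply] at hspec
  set U : Matrix (Fin d) (Fin d) ℝ := (hT.isHermitian.eigenvectorUnitary : Matrix (Fin d) (Fin d) ℝ) with hUdef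
  have hU : U * U.transpose = 1 := (Unitary.mem_iff.1 hT.isHermitian.eigenvectorUnitary.2).2
  refine ⟨U, fun i => Real.sqrt (hT.isHermitian.eigenvalues i), hU,
    fun i => Real.sqrt_pos.2 (hT.eigenvalues_pos i), ?_⟩
  have hD : (Matrix.diagonal fun i => Real.sqrt (hT.isHermitian.eigenvalues i)) *
      (Matrix.diagonal fun i => Real.sqrt (hT.isHermitian.eigenvalues i)) =
      Matrix.diagonal (RCLike.ofReal ∘ hT.isHermitian.eigenvalues) := by
    rw [Matrix.diagonal_mul_diagonal]
    congr 1
    ext i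
    exact Real.mul_self_sqrt (hT.eigenvalues_pos i).le
  rw [axisMatrix, Matrix.transpose_mul, Matrix.transpose_mul, Matrix.diagonal_transpose, ← hRdef, hRt]
  symm
  calc _ = R * (U * (Matrix.diagonal (fun i => Real.sqrt (hT.isHermitian.eigenvalues i)) *
        Matrix.diagonal fun i => Real.sqrt (hT.isHermitian.eigenvalues i)) * U.transpose) * R := by
        simp only [Matrix.mul_assoc]
    _ = R * (R⁻¹ * S * R⁻¹) * R := by
        rw [hD]
        congr 2
        exact hspec.symm
    _ = (R * R⁻¹) * S * (R⁻¹ * R) := by simp only [Matrix.mul_assoc]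
    _ = S := by
        rw [Matrix.mul_nonsing_inv _ hunit, Matrix.nonsing_inv_mul _ hunit, Matrix.one_mul,
          Matrix.mul_one]

/-! ### Pulling the divergence back to axis coordinates -/

section Pullback

variable {p p₀ q₀ : E d → ℝ} {f : ℝ → ℝ} {μ : E d} {M : Matrix (Fin d) (Fin d) ℝ}

theorem apply_add_act_matSqrt (hM : M.PosDef) (hp : ∀ z, p z = locScale p₀ μ M z) (t : E d) :
    p (μ + act (matSqrt M) t) = p₀ t * (Real.sqrt M.det)⁻¹ := by
  rw [hp, locScale, add_sub_cancel_left, act_inv_act (det_matSqrt_ne_zero hM)]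

theorem log_apply_add_act_matSqrt (hM : M.PosDef) (hp : ∀ z, p z = locScale p₀ μ M z)
    (hp₀ : ∀ t, 0 < p₀ t ∧ f ‖t‖ = Real.log (p₀ t)) (t : E d) :
    Real.log (p (μ + act (matSqrt M) t)) = f ‖t‖ - Real.log (Real.sqrt M.det) := by
  rw [apply_add_act_matSqrt hM hp, Real.log_mul (hp₀ t).1.ne'
    (inv_ne_zero (Real.sqrt_pos.2 hM.det_pos).ne'), Real.log_inv, (hp₀ t).2]
  ring

/-- The Jacobian cancels the normalizing factor of the location-scale density. Inside the logarithm
`√|M|` cancels between the two densities, leaving `∑ log lᵢ`, and `U` disappears because the profile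
is radial. -/
theorem phiIntegrand_axisMatrix (φ : ℝ → ℝ) (hM : M.PosDef) (hp : ∀ z, p z = locScale p₀ μ M z)
    (hp₀ : ∀ t, 0 < p₀ t ∧ f ‖t‖ = Real.log (p₀ t)) (hq₀_pos : ∀ z, 0 < q₀ z)
    (hq₀ : SphericallySymmetric q₀) {U : Matrix (Fin d) (Fin d) ℝ} (hU : U * U.transpose = 1)
    {l : Fin d → ℝ} (hl : ∀ i, 0 < l i) (b x : E d) :
    |(axisMatrix M U l).det| * phiIntegrand φ p (locScale q₀ (μ + act (matSqrt M * U) b)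
      (axisMatrix M U l * (axisMatrix M U l).transpose))
        (μ + act (matSqrt M * U) b + act (axisMatrix M U l) x) =
      axisIntegrand φ (fun t => f ‖t‖) q₀ b l x := by
  have hA := det_axisMatrix_ne_zero hM hU hl
  have hpt : μ + act (matSqrt M * U) b + act (axisMatrix M U l) x =
      μ + act (matSqrt M) (act U (b + scaleBy l x)) := by
    rw [axisMatrix, act_mul (matSqrt M * U), act_diagonal, add_assoc, ← act_add, act_mul]
  have hlogp := log_apply_add_act_matSqrt hM hp hp₀ (act U (b + scaleBy l x))
  rw [norm_act_of_mul_transpose_eq_one hU, ← hpt] at hlogp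
  have hpos : 0 < p (μ + act (matSqrt M * U) b + act (axisMatrix M U l) x) := by
    rw [hpt, apply_add_act_matSqrt hM hp]
    exact mul_pos (hp₀ _).1 (inv_pos.2 (Real.sqrt_pos.2 hM.det_pos))
  have hsqrt : Real.sqrt M.det ≠ 0 := (Real.sqrt_pos.2 hM.det_pos).ne'
  have hlogdet : Real.log |(axisMatrix M U l).det| =
      Real.log (Real.sqrt M.det) + ∑ i, Real.log (l i) := by
    rw [abs_det_axisMatrix hM hU hl, Real.log_mul hsqrt
      (Finset.prod_pos fun i _ => hl i).ne', Real.log_prod fun i _ => (hl i).ne']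
  have habs : |(axisMatrix M U l).det| ≠ 0 := abs_ne_zero.2 hA
  rw [phiIntegrand, locScale_mul_transpose hq₀ _ hA, axisIntegrand, logRatio,
    Real.log_div hpos.ne' (mul_ne_zero (hq₀_pos x).ne' (inv_ne_zero habs)),
    Real.log_mul (hq₀_pos x).ne' (inv_ne_zero habs), Real.log_inv, hlogp, hlogdet]
  rw [mul_left_comm, mul_left_comm _ (q₀ x), mul_inv_cancel₀ habs, mul_one]
  congr 2
  ring

theorem phiDiv_axisMatrix (φ : ℝ → ℝ) (hM : M.PosDef) (hp : ∀ z, p z = locScale p₀ μ M z)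
    (hp₀ : ∀ t, 0 < p₀ t ∧ f ‖t‖ = Real.log (p₀ t)) (hq₀_pos : ∀ z, 0 < q₀ z)
    (hq₀ : SphericallySymmetric q₀) {U : Matrix (Fin d) (Fin d) ℝ} (hU : U * U.transpose = 1)
    {l : Fin d → ℝ} (hl : ∀ i, 0 < l i) (b : E d) :
    phiDiv φ p (locScale q₀ (μ + act (matSqrt M * U) b)
      (axisMatrix M U l * (axisMatrix M U l).transpose)) =
      ∫ x, axisIntegrand φ (fun t => f ‖t‖) q₀ b l x := by
  rw [phiDiv, integral_eq_integral_comp_add_act (det_axisMatrix_ne_zero hM hU hl)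
    (μ + act (matSqrt M * U) b)]
  simp_rw [phiIntegrand_axisMatrix φ hM hp hp₀ hq₀_pos hq₀ hU hl]

theorem integrable_axisIntegrand {φ : ℝ → ℝ} (hM : M.PosDef) (hp : ∀ z, p z = locScale p₀ μ M z)
    (hp₀ : ∀ t, 0 < p₀ t ∧ f ‖t‖ = Real.log (p₀ t)) (hq₀_pos : ∀ z, 0 < q₀ z)
    (hq₀ : SphericallySymmetric q₀)
    (hfin : ∀ (ν : E d) (S : Matrix (Fin d) (Fin d) ℝ), S.PosDef →
      Integrable (phiIntegrand φ p (locScale q₀ ν S)) volume)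
    {l : Fin d → ℝ} (hl : ∀ i, 0 < l i) (b : E d) :
    Integrable (axisIntegrand φ (fun t => f ‖t‖) q₀ b l) volume := by
  -- The axis integrand does not depend on `U`, so the identity suffices.
  have hU : (1 : Matrix (Fin d) (Fin d) ℝ) * (1 : Matrix (Fin d) (Fin d) ℝ).transpose = 1 := by
    simp
  have hA := det_axisMatrix_ne_zero hM hU hl
  have h := (integrable_iff_integrable_comp_add_act hA (μ + act (matSqrt M * 1) b) _).1
    (hfin (μ + act (matSqrt M * 1) b) _ (posDef_mul_transpose hA))
  simpa only [phiIntegrand_axisMatrix φ hM hp hp₀ hq₀_pos hq₀ hU hl] using h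

theorem add_act_combo (A : Matrix (Fin d) (Fin d) ℝ) (μ x y : E d) {a b : ℝ} (hab : a + b = 1) :
    μ + act A (a • x + b • y) = a • (μ + act A x) + b • (μ + act A y) := by
  obtain rfl : a = 1 - b := by linarith
  rw [act_add, act_smul, act_smul]
  module

/-- The profile is `log p` after an affine substitution, up to an additive constant, and the weights
sum to one. -/
theorem concaveOn_profile (hM : M.PosDef) (hp : ∀ z, p z = locScale p₀ μ M z)
    (hp₀ : ∀ t, 0 < p₀ t ∧ f ‖t‖ = Real.log (p₀ t)) (hconc : LogConcaveOn Set.univ p) :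
    ConcaveOn ℝ Set.univ fun t : E d => f ‖t‖ := by
  have hpos : ∀ t, 0 < p (μ + act (matSqrt M) t) := fun t => by
    rw [apply_add_act_matSqrt hM hp]
    exact mul_pos (hp₀ _).1 (inv_pos.2 (Real.sqrt_pos.2 hM.det_pos))
  refine concaveOn_iff_forall_pos.2 ⟨convex_univ, fun x _ y _ a b ha hb hab => ?_⟩
  have h := hconc.2.2 (μ + act (matSqrt M) x) (Set.mem_univ _) (μ + act (matSqrt M) y)
    (Set.mem_univ _) a b ha hb hab
  rw [← add_act_combo _ _ _ _ hab] at h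
  have h' := Real.log_le_log (mul_pos (Real.rpow_pos_of_pos (hpos x) a)
    (Real.rpow_pos_of_pos (hpos y) b)) h
  rw [Real.log_mul (Real.rpow_pos_of_pos (hpos x) a).ne' (Real.rpow_pos_of_pos (hpos y) b).ne',
    Real.log_rpow (hpos x), Real.log_rpow (hpos y)] at h'
  simp only [log_apply_add_act_matSqrt hM hp hp₀] at h'
  obtain rfl : a = 1 - b := by linarith
  simp only [smul_eq_mul]
  linarith

theorem exists_strictConcaveOn_profile (hM : M.PosDef) (hp : ∀ z, p z = locScale p₀ μ M z)
    (hp₀ : ∀ t, 0 < p₀ t ∧ f ‖t‖ = Real.log (p₀ t))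
    (hstrict : ∃ W : Set (E d), IsOpen W ∧ W.Nonempty ∧ StrictLogConcaveOn W p) :
    ∃ V : Set (E d), IsOpen V ∧ V.Nonempty ∧ StrictConcaveOn ℝ V fun t : E d => f ‖t‖ := by
  obtain ⟨W, hW, ⟨w, hw⟩, hWc, -, hlt⟩ := hstrict
  have hR := det_matSqrt_ne_zero hM
  have hpos : ∀ t, 0 < p (μ + act (matSqrt M) t) := fun t => by
    rw [apply_add_act_matSqrt hM hp]
    exact mul_pos (hp₀ _).1 (inv_pos.2 (Real.sqrt_pos.2 hM.det_pos))
  refine ⟨(fun t => μ + act (matSqrt M) t) ⁻¹' W,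
    hW.preimage (continuous_const.add (continuous_act _)), ⟨act (matSqrt M)⁻¹ (w - μ), ?_⟩, ?_, ?_⟩
  · simpa [act_act_inv hR] using hw
  · intro x hx y hy a b ha hb hab
    have := hWc hx hy ha hb hab
    rw [← add_act_combo _ _ _ _ hab] at this
    exact this
  · intro x hx y hy hne a b ha hb hab
    have h := hlt _ hx _ hy (fun he => hne (act_injective hR (add_left_cancel he))) a b ha hb hab
    rw [← add_act_combo _ _ _ _ hab] at h
    have h' := Real.log_lt_log (mul_pos (Real.rpow_pos_of_pos (hpos x) a)
      (Real.rpow_pos_of_pos (hpos y) b)) h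
    rw [Real.log_mul (Real.rpow_pos_of_pos (hpos x) a).ne' (Real.rpow_pos_of_pos (hpos y) b).ne',
      Real.log_rpow (hpos x), Real.log_rpow (hpos y)] at h'
    simp only [log_apply_add_act_matSqrt hM hp hp₀] at h'
    obtain rfl : a = 1 - b := by linarith
    simp only [smul_eq_mul]
    linarith

end Pullback

end PhiVI

end

/-! ### The unique minimizer -/

theorem theorem2 {d : ℕ} (φ : ℝ → ℝ) (hφ : PhiVI.IsDivergenceGenerator φ)
    (hφ_anti : StrictAnti φ)
    (q₀ : PhiVI.E d → ℝ) (hq₀ : PhiVI.IsDensity q₀) (hq₀_pos : ∀ z, 0 < q₀ z)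
    (hq₀_symm : PhiVI.SphericallySymmetric q₀)
    (p : PhiVI.E d → ℝ) (hp : PhiVI.IsDensity p)
    (hp_conc : PhiVI.SomewhereStrictlyLogConcave p)
    (μ : PhiVI.E d) (M : Matrix (Fin d) (Fin d) ℝ)
    (hp_symm : PhiVI.EllipticallySymmetric p μ M)
    (f : ℝ → ℝ) (hf : PhiVI.IsRadialLogProfile f p μ M)
    (hf_C1 : ContDiffOn ℝ 1 f (Set.Ici 0))
    (hfin : ∀ (ν : PhiVI.E d) (S : Matrix (Fin d) (Fin d) ℝ), S.PosDef →
      Integrable (PhiVI.phiIntegrand φ p (PhiVI.locScale q₀ ν S)) volume) :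
    ∃ γ : ℝ, 0 < γ ∧ (γ ^ 2 • M).PosDef ∧
      ∀ (ν : PhiVI.E d) (S : Matrix (Fin d) (Fin d) ℝ), S.PosDef →
        (ν, S) ≠ (μ, γ ^ 2 • M) →
        PhiVI.phiDiv φ p (PhiVI.locScale q₀ μ (γ ^ 2 • M)) <
          PhiVI.phiDiv φ p (PhiVI.locScale q₀ ν S) := by
  obtain ⟨p₀, hpp₀, hp₀⟩ := hf
  have hM := hp_symm.posDef
  rcases Nat.eq_zero_or_pos d with rfl | hd
  -- In dimension zero there is only one pair `(ν, S)`.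
  · exact ⟨1, one_pos, by simpa using hM, fun ν S _ hne => absurd (Subsingleton.elim _ _) hne⟩
  have : NeZero d := ⟨hd.ne'⟩
  have haxis : PhiVI.AxisProblem φ (fun t : PhiVI.E d => f ‖t‖) q₀ :=
    { convex := hφ.convex
      anti := hφ_anti
      map_zero := hφ.map_zero
      density := hq₀
      pos := hq₀_pos
      symm := hq₀_symm
      profile_symm := fun x y hxy => congrArg f hxy
      profile_concave := PhiVI.concaveOn_profile hM hpp₀ hp₀ hp_conc.1
      profile_strict := PhiVI.exists_strictConcaveOn_profile hM hpp₀ hp₀ hp_conc.2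
      integrable := fun b _ hl =>
        PhiVI.integrable_axisIntegrand hM hpp₀ hp₀ hq₀_pos hq₀_symm hfin hl b }
  obtain ⟨γ, hγ, hmin⟩ := haxis.exists_unique_minimizer
  refine ⟨γ, hγ, hM.smul (by positivity), fun ν S hS hne => ?_⟩
  obtain ⟨U, l, hU, hl, rfl⟩ := PhiVI.exists_axisMatrix_mul_transpose hM hS
  have hdet : (PhiVI.matSqrt M * U).det ≠ 0 := by
    rw [Matrix.det_mul]
    refine mul_ne_zero (PhiVI.det_matSqrt_ne_zero hM) (abs_ne_zero.1 ?_)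
    rw [PhiVI.abs_det_eq_one_of_mul_transpose hU]
    exact one_ne_zero
  obtain ⟨b, rfl⟩ : ∃ b, ν = μ + PhiVI.act (PhiVI.matSqrt M * U) b :=
    ⟨PhiVI.act (PhiVI.matSqrt M * U)⁻¹ (ν - μ), by rw [PhiVI.act_act_inv hdet, add_sub_cancel]⟩
  -- The `U` adapted to `S` also represents `γ² M`, with all axes equal to `γ`, so both divergences
  -- are compared in the same coordinates.
  have hcenter := PhiVI.phiDiv_axisMatrix φ hM hpp₀ hp₀ hq₀_pos hq₀_symm hU (fun _ => hγ) 0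
  have hzero : μ + PhiVI.act (PhiVI.matSqrt M * U) 0 = μ := by simp [PhiVI.act]
  rw [hzero, PhiVI.axisMatrix_const_mul_transpose hM hU] at hcenter
  rw [hcenter, PhiVI.phiDiv_axisMatrix φ hM hpp₀ hp₀ hq₀_pos hq₀_symm hU hl b]
  refine hmin b l hl ?_
  rintro ⟨rfl, rfl⟩
  rw [hzero, PhiVI.axisMatrix_const_mul_transpose hM hU] at hne
  exact hne rfl
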